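/- Let $q=2^h$ with $h>2$, let $k\ge 2$, and let $V$ be a $2k$-dimensional vector space over $\mathbb{F}_q$, so that $\mathrm{PG}(V)=\mathrm{PG}(2k-1,q)$. An $\mathbb{F}_2$-linear set of rank $t$ is a point set $L_U=\{\langle u\rangle_{\mathbb{F}_q} : u\in U\setminus\{0\}\}$ with $U$ an $\mathbb{F}_2$-subspace of $V$ of dimension $t$; it is scattered if $\dim_{\mathbb{F}_2}(U\cap P)\le 1$ for every one-dimensional $\mathbb{F}_q$-subspace $P$ of $V$. A scattered $\mathbb{F}_2$-linear set $D$ of rank $kh$ in $\mathrm{PG}(2k-1,q)$ is said to be of pseudoregulus type if there are $m=\frac{q^k-1}{q-1}$ pairwise disjoint lines $s_1,\dots,s_m$ of $\mathrm{PG}(2k-1,q)$ such that (1) $|D\cap s_i|=q-1$ for every $i$, and (2) there are exactly two $(k-1)$-dimensional projective subspaces $T_1,T_2$ of $\mathrm{PG}(2k-1,q)$ that are disjoint from $D$ and meet every line $s_i$. Proposition. If $D$ is the point set of an $\mathbb{F}_2$-linear set of pseudoregulus type in $\mathrm{PG}(2k-1,q)$, $q=2^h$, $h>2$, $k\ge 2$,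 then every line of $\mathrm{PG}(2k-1,q)$ meets $D$ in $0$, $1$, $3$ or $q-1$ points. -/

import Mathlib

open scoped LinearAlgebra.Projectivization

section LinearSets

variable (F K : Type*) {V : Type*} [Field F] [Field K] [Algebra F K] [AddCommGroup V]
  [Module K V] [Module F V] [IsScalarTower F K V]

/-- The `F`-linear set `L_U` of the projective space `PG(V)`, with `V` a vector space over the
extension field `K` of `F`: the set of points `⟨u⟩_K`, where `u` runs over the nonzero vectors of
the `F`-subspace `U` of `V`. -/
def linearSet (U : Submodule F V) : Set (ℙ K V) :=
  {P | ∃ (u : V) (hu : u ≠ 0), u ∈ U ∧ P = Projectivization.mk K u hu}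

/-- `U` is scattered: every element of the Desarguesian spread, that is, every point `⟨v⟩_K`
of `PG(V)` regarded as an `F`-subspace of `V`, meets `U` in an `F`-subspace of dimension at most
one, i.e. in at most a point of the projective space over `F`. -/
def IsScatteredSubspace (U : Submodule F V) : Prop :=
  ∀ P : ℙ K V, Module.rank F ↥(U ⊓ P.submodule.restrictScalars F) ≤ 1

/-- A projective subspace that belongs to a vector subspace of dimension `d`, i.e. one of
projective dimension `d - 1`. Lines are the projective subspaces with `d = 2`. -/
def HasVectorDim {K V : Type*} [Field K] [AddCommGroup V] [Module K V]
    (T : Projectivization.Subspace K V) (d : ℕ) : Prop :=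
  Module.finrank K ↥(Projectivization.Subspace.submodule T) = d

/-- With `q = |F|` and `n = [K : F]`: the point set `S` of `PG(V) = PG(2k-1, q^n)` is a scattered
`F`-linear set of rank `kn`, where `n, k ≥ 2`, and is of pseudoregulus type, that is,
* there are `m = (q^(nk) - 1) / (q^n - 1)` pairwise disjoint lines `s i`, each of which meets `S`
  in exactly `(q^n - 1) / (q - 1)` points, and
* there are exactly two `(k-1)`-dimensional projective subspaces that are disjoint from `S` and
  meet every line `s i`. -/
def IsPseudoregulusType [Finite F] [Finite K] (k : ℕ) (S : Set (ℙ K V)) : Prop :=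
  2 ≤ k ∧ 2 ≤ Module.finrank F K ∧ Module.finrank K V = 2 * k ∧
  (∃ U : Submodule F V, Module.finrank F U = k * Module.finrank F K ∧
    IsScatteredSubspace F K U ∧ S = linearSet F K U) ∧
  ∃ s : Fin ((Nat.card F ^ (Module.finrank F K * k) - 1) /
        (Nat.card F ^ Module.finrank F K - 1)) → Projectivization.Subspace K V,
    (∀ i, HasVectorDim (s i) 2) ∧
    (∀ i j, i ≠ j → Disjoint (s i : Set (ℙ K V)) (s j : Set (ℙ K V))) ∧
    (∀ i, (S ∩ (s i : Set (ℙ K V))).ncard =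
      (Nat.card F ^ Module.finrank F K - 1) / (Nat.card F - 1)) ∧
    ∃ T₁ T₂ : Projectivization.Subspace K V, T₁ ≠ T₂ ∧
      {T : Projectivization.Subspace K V | HasVectorDim T k ∧
        Disjoint (T : Set (ℙ K V)) S ∧
        ∀ i, ((T : Set (ℙ K V)) ∩ (s i : Set (ℙ K V))).Nonempty} = {T₁, T₂}

end LinearSets

/-! Over `𝔽₂`, let `D` come from the scattered subspace `U`, so points of `D` are nonzero vectors of
`U`. Each line `s i` carries an `h`-dimensional part of `U`, and counting shows that these parts
cover `U`. A transversal space `T` meets `U` trivially, so every vector of `s i` is a vector of `U`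
plus one of `T`, both in `s i` (`exists_add_of_transversal`). Let `l` contain distinct nonzero `u, v
∈ U`. If both lie in one `s i`, then `l = s i`. Otherwise take `a • u + b • v ∈ U` and split both
summands: the `T`-parts add up to a vector of `U ∩ T = 0`, and lie in two disjoint lines, so both
vanish. Hence `a • u, b • v ∈ U`, scatteredness forces `a, b ∈ {0, 1}`, and only `u, v, u + v`
remain. -/

section Lines

variable {K V : Type*} [Field K] [AddCommGroup V] [Module K V]

/-- A two-dimensional subspace is spanned by any two independent vectors in it. -/
lemma span_pair_eq_of_finrank_two {L : Submodule K V} (hL : Module.finrank K L = 2) {u v : V}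
    (hu : u ∈ L) (hv : v ∈ L) (huv : LinearIndependent K ![u, v]) :
    Submodule.span K {u, v} = L := by
  have : FiniteDimensional K L := Module.finite_of_finrank_pos (by omega)
  refine Submodule.eq_of_le_of_finrank_le (Submodule.span_le.2 ?_) ?_
  · rintro x (rfl | rfl) <;> assumption
  · have h := finrank_span_eq_card huv
    rw [Matrix.range_cons_cons_empty] at h
    rw [h, hL, Fintype.card_fin]

lemma submodule_inf_eq_bot_of_disjoint {s t : Projectivization.Subspace K V}
    (h : Disjoint (s : Set (ℙ K V)) (t : Set (ℙ K V))) {x : V}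
    (hs : x ∈ Projectivization.Subspace.submodule s)
    (ht : x ∈ Projectivization.Subspace.submodule t) : x = 0 := by
  by_contra hx
  exact Set.disjoint_left.1 h ((s.mem_submodule_iff hx).1 hs) ((t.mem_submodule_iff hx).1 ht)

end Lines

section ScatteredOverTwo

variable {K V : Type*} [Field K] [Algebra (ZMod 2) K] [AddCommGroup V] [Module K V]
  [Module (ZMod 2) V] [IsScalarTower (ZMod 2) K V] {U : Submodule (ZMod 2) V}

/-- A nonzero vector of a scattered `𝔽₂`-subspace has no further multiples in that subspace than
zero and itself. -/
lemma IsScatteredSubspace.eq_zero_or_one (hU : IsScatteredSubspace (ZMod 2) K U) {u : V}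
    (hu : u ∈ U) (hu0 : u ≠ 0) {a : K} (ha : a • u ∈ U) : a = 0 ∨ a = 1 := by
  have hr := hU (Projectivization.mk K u hu0)
  rw [rank_submodule_le_one_iff'] at hr
  obtain ⟨v, hv⟩ := hr
  have key : ∀ x ∈ U, x ∈ Submodule.span K {u} → x = 0 ∨ x = v := by
    intro x hx hxs
    obtain ⟨r, rfl⟩ := Submodule.mem_span_singleton.1 (hv ⟨hx, hxs⟩)
    fin_cases r
    · left; exact zero_smul _ _
    · right; exact one_smul _ _
  have h1 := (key u hu (Submodule.mem_span_singleton_self u)).resolve_left hu0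
  rcases key _ ha (Submodule.smul_mem _ _ (Submodule.mem_span_singleton_self u)) with h2 | h2
  · exact Or.inl ((smul_eq_zero.1 h2).resolve_right hu0)
  · right
    rw [← h1] at h2
    have h3 : (a - 1) • u = 0 := by rw [sub_smul, h2, one_smul, sub_self]
    exact sub_eq_zero.1 ((smul_eq_zero.1 h3).resolve_right hu0)

lemma IsScatteredSubspace.eq_of_mk_eq (hU : IsScatteredSubspace (ZMod 2) K U) {u v : V}
    (hu : u ∈ U) (hv : v ∈ U) (hu0 : u ≠ 0) (hv0 : v ≠ 0)
    (h : Projectivization.mk K u hu0 = Projectivization.mk K v hv0) : u = v := by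
  obtain ⟨a, rfl⟩ := (Projectivization.mk_eq_mk_iff' K u v hu0 hv0).1 h
  rcases hU.eq_zero_or_one hv hv0 hu with rfl | rfl
  · exact absurd (zero_smul K v) hu0
  · exact one_smul K v

/-- The points of a scattered `𝔽₂`-linear set in a projective subspace correspond to the nonzero
vectors of the underlying `𝔽₂`-subspace in it. -/
lemma IsScatteredSubspace.ncard_inter (hU : IsScatteredSubspace (ZMod 2) K U)
    (T : Projectivization.Subspace K V) :
    (linearSet (ZMod 2) K U ∩ (T : Set (ℙ K V))).ncard =
      Nat.card {u : V // u ∈ U ∧ u ∈ Projectivization.Subspace.submodule T ∧ u ≠ 0} := by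
  rw [← Nat.card_coe_set_eq]
  symm
  refine Nat.card_eq_of_bijective
    (fun u => ⟨Projectivization.mk K u.1 u.2.2.2, ⟨u.1, u.2.2.2, u.2.1, rfl⟩,
      (T.mem_submodule_iff u.2.2.2).1 u.2.2.1⟩) ⟨?_, ?_⟩
  · rintro ⟨u, hu, _, hu0⟩ ⟨v, hv, _, hv0⟩ h
    exact Subtype.ext (hU.eq_of_mk_eq hu hv hu0 hv0 (Subtype.mk.inj h))
  · rintro ⟨_, ⟨u, hu0, hu, rfl⟩, hT⟩
    exact ⟨⟨u, hu, (T.mem_submodule_iff hu0).2 hT, hu0⟩, rfl⟩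

lemma card_nonzero_add_one {V : Type*} [AddCommGroup V] [Module (ZMod 2) V] [Finite V]
    (A : Submodule (ZMod 2) V) :
    Nat.card {u : V // u ∈ A ∧ u ≠ 0} + 1 = Nat.card A := by
  have h := Set.ncard_sdiff_singleton_add_one (s := (A : Set V)) A.zero_mem (Set.toFinite _)
  rw [← Nat.card_coe_set_eq, ← Nat.card_coe_set_eq] at h
  exact h

lemma linearIndependent_pair_of_scattered (hU : IsScatteredSubspace (ZMod 2) K U) {u v : V}
    (hu : u ∈ U) (hv : v ∈ U) (hu0 : u ≠ 0) (hv0 : v ≠ 0) (huv : u ≠ v) :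
    LinearIndependent K ![u, v] := by
  rw [LinearIndependent.pair_iff' hu0]
  rintro a rfl
  rcases hU.eq_zero_or_one hu hu0 hv with rfl | rfl
  · exact hv0 (zero_smul K u)
  · exact huv (one_smul K u).symm

/-- Points in `s` are the nonzero vectors of an `𝔽₂`-space, which thus has `2 ^ h` elements. -/
lemma IsScatteredSubspace.finrank_inter [Finite V] (hU : IsScatteredSubspace (ZMod 2) K U)
    {s : Projectivization.Subspace K V} {h : ℕ}
    (hs : (linearSet (ZMod 2) K U ∩ (s : Set (ℙ K V))).ncard = 2 ^ h - 1) :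
    Module.finrank (ZMod 2)
      ↥(U ⊓ (Projectivization.Subspace.submodule s).restrictScalars (ZMod 2)) = h := by
  set A := U ⊓ (Projectivization.Subspace.submodule s).restrictScalars (ZMod 2) with hA
  have h1 := card_nonzero_add_one A
  have h2 : Nat.card {u : V // u ∈ A ∧ u ≠ 0} = 2 ^ h - 1 := by
    rw [← hs, hU.ncard_inter]
    refine Nat.card_congr (Equiv.subtypeEquivRight fun x => ?_)
    rw [hA, Submodule.mem_inf, Submodule.restrictScalars_mem, and_assoc]
  rw [Module.natCard_eq_pow_finrank (K := ZMod 2) (V := A), Nat.card_zmod, h2,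
    Nat.sub_add_cancel Nat.one_le_two_pow] at h1
  exact (Nat.pow_right_injective le_rfl h1).symm

/-- A line of weight `h` is the direct sum, over `𝔽₂`, of its vectors in `U` and its vectors in a
transversal space disjoint from `U`; only the existence of the decomposition is stated. -/
lemma exists_add_of_transversal [Finite V] [Finite K] {S T : Submodule K V}
    (hS : Module.finrank K S = 2)
    (hUS : Module.finrank (ZMod 2) ↥(U ⊓ S.restrictScalars (ZMod 2)) = Module.finrank (ZMod 2) K)
    (hUT : ∀ x ∈ U, x ∈ T → x = 0) (hTS : ∃ x ∈ T, x ∈ S ∧ x ≠ 0) {v : V} (hv : v ∈ S) :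
    ∃ u ∈ U, u ∈ S ∧ ∃ t ∈ T, t ∈ S ∧ u + t = v := by
  set A := U ⊓ S.restrictScalars (ZMod 2) with hA
  set B := (T ⊓ S).restrictScalars (ZMod 2) with hB
  have hAB : A ⊓ B = ⊥ := by
    rw [eq_bot_iff]
    rintro x ⟨⟨hxU, -⟩, hxT, -⟩
    exact hUT x hxU hxT
  have hsum := Submodule.finrank_sup_add_finrank_inf_eq A B
  rw [hAB, finrank_bot, add_zero, hUS] at hsum
  have hBK : Module.finrank (ZMod 2) B = Module.finrank (ZMod 2) K * Module.finrank K ↥(T ⊓ S) :=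
    (Module.finrank_mul_finrank (ZMod 2) K ↥(T ⊓ S)).symm
  have hSK : Module.finrank (ZMod 2) ↥(S.restrictScalars (ZMod 2)) =
      Module.finrank (ZMod 2) K * Module.finrank K S :=
    (Module.finrank_mul_finrank (ZMod 2) K S).symm
  have hpos : 1 ≤ Module.finrank K ↥(T ⊓ S) := by
    rw [Submodule.one_le_finrank_iff]
    rintro h
    obtain ⟨x, hxT, hxS, hx⟩ := hTS
    exact hx ((Submodule.mem_bot K).1 (h ▸ ⟨hxT, hxS⟩))
  have hle : A ⊔ B ≤ S.restrictScalars (ZMod 2) :=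
    sup_le inf_le_right fun x hx => hx.2
  have heq : A ⊔ B = S.restrictScalars (ZMod 2) := by
    -- With `n = [K : 𝔽₂]` and `d = dim (T ⊓ S) ≥ 1`, this is `2n ≤ n + nd`.
    refine Submodule.eq_of_le_of_finrank_le hle ?_
    rw [hsum, hSK, hBK, hS]
    nlinarith [Nat.zero_le (Module.finrank (ZMod 2) K)]
  obtain ⟨u, hu, t, ht, h⟩ := Submodule.mem_sup.1 (show v ∈ A ⊔ B from heq ▸ hv)
  exact ⟨u, hu.1, hu.2, t, ht.1, ht.2, h⟩

/-- Pairwise disjoint lines that together carry enough vectors of `U` cover `U`. -/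
lemma exists_mem_of_card [Finite V] {m n h : ℕ} (S : Fin m → Submodule K V)
    (hdisj : ∀ i j, i ≠ j → ∀ x ∈ S i, x ∈ S j → x = 0)
    (hUS : ∀ i, Module.finrank (ZMod 2) ↥(U ⊓ (S i).restrictScalars (ZMod 2)) = h)
    (hU : Module.finrank (ZMod 2) U = n) (hm : m * (2 ^ h - 1) = 2 ^ n - 1)
    {u : V} (hu : u ∈ U) (hu0 : u ≠ 0) : ∃ i, u ∈ S i := by
  let f : (Σ i, {u : V // u ∈ U ⊓ (S i).restrictScalars (ZMod 2) ∧ u ≠ 0}) →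
      {u : V // u ∈ U ∧ u ≠ 0} := fun p => ⟨p.2.1, p.2.2.1.1, p.2.2.2⟩
  have hf : Function.Injective f := by
    rintro ⟨i, x, ⟨hxU, hxi⟩, hx0⟩ ⟨j, y, ⟨hyU, hyj⟩, hy0⟩ hxy
    obtain rfl : x = y := congrArg Subtype.val hxy
    obtain rfl : i = j := by
      by_contra hij
      exact hx0 (hdisj i j hij x hxi hyj)
    rfl
  have hcard : ∀ (A : Submodule (ZMod 2) V) (d : ℕ), Module.finrank (ZMod 2) A = d →
      Nat.card {u : V // u ∈ A ∧ u ≠ 0} = 2 ^ d - 1 := by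
    rintro A d rfl
    have h1 := card_nonzero_add_one A
    rw [Module.natCard_eq_pow_finrank (K := ZMod 2) (V := A), Nat.card_zmod] at h1
    omega
  -- Both sides have `2 ^ n - 1` elements, so the injection `f` is onto.
  have hb := (Nat.bijective_iff_injective_and_card f).2 ⟨hf, by
    rw [Nat.card_sigma, hcard U n hU, ← hm]
    simp only [fun i => hcard _ _ (hUS i)]
    simp⟩
  obtain ⟨⟨i, x, ⟨_, hx⟩, hx0⟩, hfx⟩ := hb.2 ⟨u, hu, hu0⟩
  obtain rfl : x = u := congrArg Subtype.val hfx
  exact ⟨i, hx⟩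

end ScatteredOverTwo

theorem mainTheorem8 {K V : Type*} [Field K] [Finite K] [Algebra (ZMod 2) K]
    [AddCommGroup V] [Module K V] [Module (ZMod 2) V] [IsScalarTower (ZMod 2) K V]
    (h k : ℕ) (hh : 2 < h) (hk : 2 ≤ k)
    (hK : Nat.card K = 2 ^ h) (hV : Module.finrank K V = 2 * k)
    (D : Set (ℙ K V)) (hD : IsPseudoregulusType (ZMod 2) K k D)
    (l : Projectivization.Subspace K V) (hl : HasVectorDim l 2) :
    (D ∩ (l : Set (ℙ K V))).ncard = 0 ∨ (D ∩ (l : Set (ℙ K V))).ncard = 1 ∨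
      (D ∩ (l : Set (ℙ K V))).ncard = 3 ∨ (D ∩ (l : Set (ℙ K V))).ncard = 2 ^ h - 1 := by
  have hKh : Module.finrank (ZMod 2) K = h := by
    rw [Module.natCard_eq_pow_finrank (K := ZMod 2), Nat.card_zmod] at hK
    exact Nat.pow_right_injective le_rfl hK
  have : Module.Finite K V := Module.finite_of_finrank_pos (by omega)
  have : Finite V := Module.finite_of_finite K
  rw [IsPseudoregulusType, Nat.card_zmod, hKh] at hD
  obtain ⟨-, -, -, ⟨U, hUrank, hU, rfl⟩, s, hs2, hsdisj, hscard, T, T', -, hTT⟩ := hD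
  obtain ⟨-, hTD, hTs⟩ := hTT.ge (Set.mem_insert T {T'})
  have hscard' : ∀ i, (linearSet (ZMod 2) K U ∩ (s i : Set (ℙ K V))).ncard = 2 ^ h - 1 :=
    fun i => by rw [hscard i]; simp
  set S := fun i => Projectivization.Subspace.submodule (s i)
  have hSdisj : ∀ i j, i ≠ j → ∀ x ∈ S i, x ∈ S j → x = 0 :=
    fun i j hij x hi hj => submodule_inf_eq_bot_of_disjoint (hsdisj i j hij) hi hj
  have hUS := fun i => hU.finrank_inter (hscard' i)
  -- The number of lines is a truncated quotient; it is exact since `h ∣ h * k`.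
  have hm : (2 ^ (h * k) - 1) / (2 ^ h - 1) * (2 ^ h - 1) = 2 ^ (k * h) - 1 := by
    rw [mul_comm k h]
    exact Nat.div_mul_cancel (Nat.pow_sub_one_dvd_pow_sub_one 2 (dvd_mul_right h k))
  have hcover : ∀ u ∈ U, u ≠ 0 → ∃ i, u ∈ S i := fun u hu hu0 =>
    exists_mem_of_card S hSdisj hUS hUrank hm hu hu0
  have hUT : ∀ x ∈ U, x ∈ Projectivization.Subspace.submodule T → x = 0 := by
    intro x hxU hxT
    by_contra hx
    exact Set.disjoint_left.1 hTD ((T.mem_submodule_iff hx).1 hxT) ⟨x, hx, hxU, rfl⟩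
  have hsplit : ∀ i, ∀ v ∈ S i, ∃ u ∈ U, u ∈ S i ∧
      ∃ t ∈ Projectivization.Subspace.submodule T, t ∈ S i ∧ u + t = v := by
    intro i v hv
    refine exists_add_of_transversal (hs2 i) ((hUS i).trans hKh.symm) hUT ?_ hv
    obtain ⟨P, hPT, hPs⟩ := hTs i
    induction P using Projectivization.ind with
    | h x hx => exact ⟨x, (T.mem_submodule_iff hx).2 hPT, ((s i).mem_submodule_iff hx).2 hPs, hx⟩
  set L := Projectivization.Subspace.submodule l
  by_cases hpair : ∃ u v, u ∈ U ∧ v ∈ U ∧ u ∈ L ∧ v ∈ L ∧ u ≠ 0 ∧ v ≠ 0 ∧ u ≠ v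
  · obtain ⟨u, v, huU, hvU, huL, hvL, hu0, hv0, huv⟩ := hpair
    have hind := linearIndependent_pair_of_scattered hU huU hvU hu0 hv0 huv
    have hspan : Submodule.span K {u, v} = L := span_pair_eq_of_finrank_two hl huL hvL hind
    obtain ⟨i, hui⟩ := hcover u huU hu0
    obtain ⟨j, hvj⟩ := hcover v hvU hv0
    right; right
    by_cases hij : i = j
    · subst hij
      have hls : L = S i := hspan.symm.trans (span_pair_eq_of_finrank_two (hs2 i) hui hvj hind)
      rw [Projectivization.Subspace.submodule.injective hls]
      exact Or.inr (hscard' i)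
    · left
      have hall : ∀ w ∈ U, w ∈ L → w ≠ 0 → w = u ∨ w = v ∨ w = u + v := by
        intro w hwU hwL hw0
        rw [← hspan] at hwL
        obtain ⟨a, b, rfl⟩ := Submodule.mem_span_pair.1 hwL
        obtain ⟨u', hu'U, hu'i, t, htT, hti, hut⟩ := hsplit i (a • u) ((S i).smul_mem a hui)
        obtain ⟨v', hv'U, hv'j, t', ht'T, ht'j, hvt⟩ := hsplit j (b • v) ((S j).smul_mem b hvj)
        -- The sum is in `T`, and also in `U` as a difference of vectors of `U`.
        have htt : t + t' = 0 := by
          refine hUT _ ?_ (add_mem htT ht'T)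
          have : t + t' = (a • u + b • v) - (u' + v') := by rw [← hut, ← hvt]; abel
          rw [this]
          exact sub_mem hwU (add_mem hu'U hv'U)
        have ht0 : t = 0 := by
          refine hSdisj i j hij t hti ?_
          rw [eq_neg_of_add_eq_zero_left htt]
          exact neg_mem ht'j
        have ht0' : t' = 0 := by rwa [ht0, zero_add] at htt
        rw [ht0, add_zero] at hut
        rw [ht0', add_zero] at hvt
        -- Of the four cases, `a = b = 0` contradicts `w ≠ 0`.
        rcases hU.eq_zero_or_one huU hu0 (hut ▸ hu'U) with rfl | rfl <;>
        rcases hU.eq_zero_or_one hvU hv0 (hvt ▸ hv'U) with rfl | rfl <;>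
        simp_all
      have huv0 : u + v ≠ 0 := fun h0 => by
        have h1 := LinearIndependent.pair_iff.1 hind 1 1 (by simpa using h0)
        exact one_ne_zero h1.1
      rw [hU.ncard_inter]
      have hset : {w : V | w ∈ U ∧ w ∈ L ∧ w ≠ 0} = {u, v, u + v} := by
        ext w
        constructor
        · rintro ⟨h1, h2, h3⟩
          exact hall w h1 h2 h3
        · rintro (rfl | rfl | rfl)
          · exact ⟨huU, huL, hu0⟩
          · exact ⟨hvU, hvL, hv0⟩
          · exact ⟨add_mem huU hvU, add_mem huL hvL, huv0⟩
      change Nat.card ↥{w : V | w ∈ U ∧ w ∈ L ∧ w ≠ 0} = 3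
      rw [hset, Nat.card_coe_set_eq, Set.ncard_eq_three]
      exact ⟨u, v, u + v, huv, by simpa using hv0, by simpa using hu0, rfl⟩
  · have : (linearSet (ZMod 2) K U ∩ (l : Set (ℙ K V))).ncard ≤ 1 := by
      rw [hU.ncard_inter]
      refine Finite.card_le_one_iff_subsingleton.2 ⟨?_⟩
      rintro ⟨u, hu, huL, hu0⟩ ⟨v, hv, hvL, hv0⟩
      by_contra hne
      exact hpair ⟨u, v, hu, hv, huL, hvL, hu0, hv0, fun e => hne (Subtype.ext e)⟩
    omega
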